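/- Let $A$ be a partially ordered set (an alphabet, not necessarily finite), and let $A^{*}$ be the set of finite words over $A$, ordered by the Higman ordering: $a_0\cdots a_{n-1}\le b_0\cdots b_{m-1}$ if and only if there is a strictly increasing map $h:\{0,\dots,n-1\}\to\{0,\dots,m-1\}$ with $a_i\le b_{h(i)}$ for all $i$. A final segment of $A^{*}$ is a subset $F\subseteq A^{*}$ such that $\alpha\in F$ and $\alpha\le\beta$ imply $\beta\in F$. With the operation $FG=\{\alpha\beta:\alpha\in F,\ \beta\in G\}$, the set $\mathbf F(A^{*})$ of all final segments is a monoid with neutral element $A^{*}$, and the set $\mathbf F^{\circ}(A^{*})$ of nonempty final segments is a submonoid of it. Call $F\in\mathbf F(A^{*})$ irreducible if $F\ne A^{*}$ and $F$ is not of the form $GH$ with $G,H\in\mathbf F(A^{*})$ both distinct from $F$. Then $\mathbf F^{\circ}(A^{*})$ is a free monoid, that is, it is isomorphic to the monoid $X^{*}$ of words over some set $X$. Moreover, every $F\in\mathbf F^{\circ}(A^{*})$ can be written in exactly one way as a product $F=F_1F_2\cdots F_k$ of a finite (possibly empty) sequence of irreducible final segments, the empty product being $A^{*}$. -/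

import Mathlib

open scoped Pointwise

universe u

/-- The Higman ordering on the words over an ordered alphabet: `a₀ ⋯ aₙ₋₁ ≤ b₀ ⋯ bₘ₋₁` iff there
is an injective increasing map `h` of the indices with `aᵢ ≤ b_{h i}` for all `i`. -/
instance higmanLE {A : Type u} [PartialOrder A] : LE (FreeMonoid A) where
  le α β := ∃ h : Fin α.toList.length → Fin β.toList.length,
    StrictMono h ∧ ∀ i, α.toList.get i ≤ β.toList.get (h i)

theorem higman_le_iff {A : Type u} [PartialOrder A] (α β : FreeMonoid A) :
    α ≤ β ↔ ∃ l, List.Forall₂ (· ≤ ·) α.toList l ∧ l.Sublist β.toList := by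
  constructor
  · rintro ⟨h, hm, hle⟩
    refine ⟨List.ofFn fun i => β.toList.get (h i), ?_, ?_⟩
    · rw [List.forall₂_iff_get]
      refine ⟨by simp, fun i h₁ h₂ => ?_⟩
      simpa using hle ⟨i, h₁⟩
    · rw [List.sublist_iff_exists_fin_orderEmbedding_get_eq]
      refine ⟨(OrderEmbedding.ofStrictMono
        (fun i => h (Fin.cast (by simp) i)) fun i j hij => hm (by simpa using hij)), ?_⟩
      intro i
      simp
      rfl
  · rintro ⟨l, hl, hs⟩
    rw [List.sublist_iff_exists_fin_orderEmbedding_get_eq] at hs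
    obtain ⟨f, hf⟩ := hs
    have hlen := hl.length_eq
    refine ⟨fun i => f (Fin.cast hlen i), fun i j hij => f.strictMono (by simpa using hij), ?_⟩
    intro i
    rw [← hf]
    exact (List.forall₂_iff_get.1 hl).2 i i.2 (hlen ▸ i.2)

/-- `𝐅(A*)`: the final segments (upper sets) of `A*` for the Higman ordering. -/
abbrev FinalSegment (A : Type u) [PartialOrder A] : Type u := UpperSet (FreeMonoid A)

theorem higman_isUpperSet_mul {A : Type u} [PartialOrder A] {X Y : Set (FreeMonoid A)}
    (hX : IsUpperSet X) (hY : IsUpperSet Y) : IsUpperSet (X * Y) := by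
  rintro α β hαβ ⟨x, hx, y, hy, rfl⟩
  obtain ⟨l, hl, hs⟩ := (higman_le_iff _ _).1 hαβ
  have e := (List.take_append_drop x.toList.length l).symm
  have h1 : List.Forall₂ (· ≤ ·) x.toList (l.take x.toList.length) := by
    simpa using List.forall₂_take x.toList.length hl
  have h2 : List.Forall₂ (· ≤ ·) y.toList (l.drop x.toList.length) := by
    simpa using List.forall₂_drop x.toList.length hl
  rw [e, List.append_sublist_iff] at hs
  obtain ⟨r₁, r₂, hr, hs₁, hs₂⟩ := hs
  refine ⟨FreeMonoid.ofList r₁, hX ((higman_le_iff _ _).2 ⟨_, h1, hs₁⟩) hx,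
    FreeMonoid.ofList r₂, hY ((higman_le_iff _ _).2 ⟨_, h2, hs₂⟩) hy, ?_⟩
  exact FreeMonoid.toList.injective hr.symm

/-- The monoid `𝐅(A*)`: the product is `XY = {αβ : α ∈ X, β ∈ Y}`, the neutral element is `A*`. -/
instance finalSegmentMonoid {A : Type u} [PartialOrder A] : Monoid (FinalSegment A) where
  mul F G := ⟨(F : Set (FreeMonoid A)) * (G : Set (FreeMonoid A)),
    higman_isUpperSet_mul F.upper G.upper⟩
  one := ⟨Set.univ, isUpperSet_univ⟩
  mul_assoc F G H := UpperSet.ext (mul_assoc (F : Set (FreeMonoid A)) G H)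
  one_mul F := UpperSet.ext <| by
    refine Set.Subset.antisymm ?_ fun y hy => ⟨1, trivial, y, hy, one_mul y⟩
    rintro _ ⟨x, -, y, hy, rfl⟩
    exact F.upper ((higman_le_iff _ _).2
      ⟨y.toList, List.forall₂_refl _, List.sublist_append_right x.toList y.toList⟩) hy
  mul_one F := UpperSet.ext <| by
    refine Set.Subset.antisymm ?_ fun y hy => ⟨y, hy, 1, trivial, mul_one y⟩
    rintro _ ⟨x, hx, y, -, rfl⟩
    exact F.upper ((higman_le_iff _ _).2
      ⟨x.toList, List.forall₂_refl _, List.sublist_append_left x.toList y.toList⟩) hx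

/-- `𝐅°(A*)`: the submonoid of nonempty final segments. -/
def nonemptyFinalSegments (A : Type u) [PartialOrder A] : Submonoid (FinalSegment A) where
  carrier := {F | (F : Set (FreeMonoid A)).Nonempty}
  mul_mem' hF hG := Set.Nonempty.mul hF hG
  one_mem' := ⟨1, trivial⟩

/-- A final segment is irreducible if it is distinct from `A*` and is not the concatenation of two
final segments both distinct from it. -/
def IsIrreducibleSegment {A : Type u} [PartialOrder A] (F : FinalSegment A) : Prop :=
  (F : Set (FreeMonoid A)) ≠ Set.univ ∧
    ¬ ∃ G H : FinalSegment A, G ≠ F ∧ H ≠ F ∧ F = G * H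

/-! This is Levi's criterion for freeness. The least length of a word is additive on nonempty final
segments and vanishes only at `1`, so factorizations into irreducibles exist. Words of least length
also give cancellation on both sides. The crux is equidivisibility: if `F₁ * F₂ = G₁ * G₂` is
nonempty, then `F₁` and `G₁` are comparable under inclusion, and the smaller is the larger times a
residual `H`. Two factorizations into irreducibles then share their first factor, and cancelling it
gives uniqueness by induction. -/

theorem FreeMonoid.mul_eq_mul_iff {A : Type u} {x y g k : FreeMonoid A} :
    x * y = g * k ↔ (∃ c, g = x * c ∧ y = c * k) ∨ ∃ c, x = g * c ∧ k = c * y :=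
  List.append_eq_append_iff

namespace FinalSegment

variable {A : Type u} [PartialOrder A]

theorem mem_mul {F G : FinalSegment A} {w : FreeMonoid A} :
    w ∈ F * G ↔ ∃ x ∈ F, ∃ y ∈ G, x * y = w :=
  Iff.rfl

theorem mem_one (w : FreeMonoid A) : w ∈ (1 : FinalSegment A) :=
  trivial

theorem mul_mem_of_left {F : FinalSegment A} {x : FreeMonoid A} (hx : x ∈ F)
    (y : FreeMonoid A) : x * y ∈ F := by
  rw [← mul_one F]
  exact ⟨x, hx, y, mem_one y, rfl⟩

theorem mul_mem_of_right {F : FinalSegment A} {y : FreeMonoid A} (hy : y ∈ F)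
    (x : FreeMonoid A) : x * y ∈ F := by
  rw [← one_mul F]
  exact ⟨x, mem_one x, y, hy, rfl⟩

theorem eq_one_of_one_mem {F : FinalSegment A} (h : (1 : FreeMonoid A) ∈ F) : F = 1 :=
  UpperSet.ext <| Set.eq_univ_of_forall fun w => by simpa using mul_mem_of_left h w

theorem nonempty_left_of_mul {F G : FinalSegment A}
    (h : ((F * G : FinalSegment A) : Set (FreeMonoid A)).Nonempty) :
    (F : Set (FreeMonoid A)).Nonempty := by
  obtain ⟨_, x, hx, -⟩ := h
  exact ⟨x, hx⟩

theorem nonempty_right_of_mul {F G : FinalSegment A}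
    (h : ((F * G : FinalSegment A) : Set (FreeMonoid A)).Nonempty) :
    (G : Set (FreeMonoid A)).Nonempty := by
  obtain ⟨_, _, _, y, hy, -⟩ := h
  exact ⟨y, hy⟩

/-! ### Minimal length and cancellation -/

/-- The minimal length of a word of a final segment. -/
noncomputable def minLength (F : FinalSegment A) : ℕ :=
  sInf (FreeMonoid.length '' (F : Set (FreeMonoid A)))

theorem exists_length_eq_minLength {F : FinalSegment A}
    (hF : (F : Set (FreeMonoid A)).Nonempty) : ∃ x ∈ F, x.length = F.minLength :=
  Nat.sInf_mem (hF.image _)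

theorem minLength_le {F : FinalSegment A} {x : FreeMonoid A} (hx : x ∈ F) :
    F.minLength ≤ x.length :=
  Nat.sInf_le ⟨x, hx, rfl⟩

theorem minLength_mul {F G : FinalSegment A} (hF : (F : Set (FreeMonoid A)).Nonempty)
    (hG : (G : Set (FreeMonoid A)).Nonempty) :
    (F * G).minLength = F.minLength + G.minLength := by
  obtain ⟨x, hx, hxl⟩ := exists_length_eq_minLength hF
  obtain ⟨y, hy, hyl⟩ := exists_length_eq_minLength hG
  obtain ⟨w, ⟨a, ha, b, hb, rfl⟩, hw⟩ := exists_length_eq_minLength (F := F * G)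
    (Set.Nonempty.mul hF hG)
  have h₁ := minLength_le (mem_mul.2 ⟨x, hx, y, hy, rfl⟩)
  have h₂ := minLength_le ha
  have h₃ := minLength_le hb
  simp only [FreeMonoid.length_mul] at h₁ hw
  omega

theorem minLength_pos {F : FinalSegment A} (hF : (F : Set (FreeMonoid A)).Nonempty)
    (h1 : F ≠ 1) : 0 < F.minLength := by
  obtain ⟨x, hx, hxl⟩ := exists_length_eq_minLength hF
  refine Nat.pos_of_ne_zero fun h => h1 (eq_one_of_one_mem ?_)
  rwa [FreeMonoid.length_eq_zero.1 (hxl.trans h)] at hx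

/-- For `x` shortest in `F`, write `x * y = g * k` with `g ∈ F`, `k ∈ H`. Then `g` is no shorter
than `x`, so `k` is a suffix of `y`. -/
theorem subset_of_mul_subset_mul_left {F G H : FinalSegment A}
    (hF : (F : Set (FreeMonoid A)).Nonempty) (h : ∀ w ∈ F * G, w ∈ F * H) :
    ∀ y ∈ G, y ∈ H := by
  intro y hy
  obtain ⟨x, hx, hxl⟩ := exists_length_eq_minLength hF
  obtain ⟨g, hg, k, hk, e⟩ := h _ ⟨x, hx, y, hy, rfl⟩
  rcases FreeMonoid.mul_eq_mul_iff.1 e with ⟨c, rfl, rfl⟩ | ⟨c, rfl, rfl⟩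
  · have := minLength_le hg
    rw [← hxl, FreeMonoid.length_mul] at this
    obtain rfl : c = 1 := FreeMonoid.length_eq_zero.1 (by omega)
    simpa using hk
  · exact mul_mem_of_right hk c

theorem subset_of_mul_subset_mul_right {F G H : FinalSegment A}
    (hF : (F : Set (FreeMonoid A)).Nonempty) (h : ∀ w ∈ G * F, w ∈ H * F) :
    ∀ x ∈ G, x ∈ H := by
  intro x hx
  obtain ⟨y, hy, hyl⟩ := exists_length_eq_minLength hF
  obtain ⟨g, hg, k, hk, e⟩ := h _ ⟨x, hx, y, hy, rfl⟩
  rcases FreeMonoid.mul_eq_mul_iff.1 e with ⟨c, rfl, rfl⟩ | ⟨c, rfl, rfl⟩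
  · exact mul_mem_of_left hg c
  · have := minLength_le hk
    rw [← hyl, FreeMonoid.length_mul] at this
    obtain rfl : c = 1 := FreeMonoid.length_eq_zero.1 (by omega)
    simpa using hg

theorem mul_left_cancel_of_nonempty {F G H : FinalSegment A}
    (hF : (F : Set (FreeMonoid A)).Nonempty) (h : F * G = F * H) : G = H :=
  SetLike.ext fun y => ⟨subset_of_mul_subset_mul_left hF (fun _ hw => h ▸ hw) y,
    subset_of_mul_subset_mul_left hF (fun _ hw => h ▸ hw) y⟩

theorem mul_right_cancel_of_nonempty {F G H : FinalSegment A}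
    (hF : (F : Set (FreeMonoid A)).Nonempty) (h : G * F = H * F) : G = H :=
  SetLike.ext fun y => ⟨subset_of_mul_subset_mul_right hF (fun _ hw => h ▸ hw) y,
    subset_of_mul_subset_mul_right hF (fun _ hw => h ▸ hw) y⟩

/-! ### Equidivisibility -/

/-- If a word of `F₁` is outside `G₁` then every word of `F₂` is longer than some word of `G₂`. -/
theorem exists_shorter_mem_of_not_mem {F₁ F₂ G₁ G₂ : FinalSegment A} (h : F₁ * F₂ = G₁ * G₂)
    {u : FreeMonoid A} (hu : u ∈ F₁) (hu' : u ∉ G₁) {y : FreeMonoid A} (hy : y ∈ F₂) :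
    ∃ z ∈ G₂, z.length < y.length := by
  obtain ⟨g, hg, k, hk, e⟩ : u * y ∈ G₁ * G₂ := h ▸ ⟨u, hu, y, hy, rfl⟩
  rcases FreeMonoid.mul_eq_mul_iff.1 e with ⟨c, rfl, rfl⟩ | ⟨c, rfl, rfl⟩
  · exact absurd (mul_mem_of_left hg c) hu'
  · refine ⟨k, hk, ?_⟩
    rw [FreeMonoid.length_mul]
    have : c.length ≠ 0 := fun hc => hu' (by
      rw [FreeMonoid.length_eq_zero.1 hc, mul_one] at hg
      exact hg)
    omega

/-- If both inclusions failed, each of `F₂` and `G₂` would have a smaller minimal length than the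
other. -/
theorem subset_or_subset_of_mul_eq_mul {F₁ F₂ G₁ G₂ : FinalSegment A}
    (hF : (F₂ : Set (FreeMonoid A)).Nonempty) (hG : (G₂ : Set (FreeMonoid A)).Nonempty)
    (h : F₁ * F₂ = G₁ * G₂) : (∀ x ∈ F₁, x ∈ G₁) ∨ ∀ x ∈ G₁, x ∈ F₁ := by
  by_contra! hne
  obtain ⟨⟨u, hu, hu'⟩, v, hv, hv'⟩ := hne
  obtain ⟨y, hy, hyl⟩ := exists_length_eq_minLength hF
  obtain ⟨z, hz, hzl⟩ := exists_length_eq_minLength hG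
  obtain ⟨z', hz', h₁⟩ := exists_shorter_mem_of_not_mem h hu hu' hy
  obtain ⟨y', hy', h₂⟩ := exists_shorter_mem_of_not_mem h.symm hv hv' hz
  have := minLength_le hz'
  have := minLength_le hy'
  omega

/-- The left residual of `G` by `F`: the largest `H` such that `H * F ⊆ G`. -/
def residual (G F : FinalSegment A) : FinalSegment A where
  carrier := {w | ∀ y ∈ F, w * y ∈ G}
  upper' := by
    intro w w' hw h y hy
    obtain ⟨l, hl, hs⟩ := (higman_le_iff _ _).1 hw
    refine G.upper ((higman_le_iff _ _).2 ⟨l ++ y.toList, ?_, ?_⟩) (h y hy)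
    · exact List.rel_append hl (List.forall₂_refl _)
    · exact hs.append (List.Sublist.refl _)

theorem exists_mul_eq_of_subset {F₁ F₂ G₁ G₂ : FinalSegment A}
    (hF : (F₂ : Set (FreeMonoid A)).Nonempty) (hG : (G₁ : Set (FreeMonoid A)).Nonempty)
    (h : F₁ * F₂ = G₁ * G₂) (hsub : ∀ x ∈ F₁, x ∈ G₁) :
    ∃ H, F₁ = G₁ * H ∧ G₂ = H * F₂ := by
  have h₁ : ∀ x ∈ F₁, x ∈ G₁ * residual G₂ F₂ := by
    intro x hx
    classical
    -- Cut `x` after its shortest prefix `a` in `G₁`; the remainder `b` will lie in the residual.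
    have hex : ∃ n, ∃ a ∈ G₁, ∃ b, a * b = x ∧ a.length = n := ⟨_, x, hsub x hx, 1, mul_one x, rfl⟩
    obtain ⟨a, ha, b, rfl, hn⟩ := Nat.find_spec hex
    refine ⟨a, ha, b, fun y hy => ?_, rfl⟩
    obtain ⟨g, hg, k, hk, e⟩ : a * b * y ∈ G₁ * G₂ := h ▸ ⟨a * b, hx, y, hy, rfl⟩
    rw [mul_assoc] at e
    -- A prefix `g` of `a` must equal `a` by minimality; otherwise `k` is a suffix of `b * y`.
    rcases FreeMonoid.mul_eq_mul_iff.1 e with ⟨c, rfl, rfl⟩ | ⟨c, rfl, e'⟩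
    · have := Nat.find_min' hex ⟨g, hg, c * b, (mul_assoc _ _ _).symm, rfl⟩
      rw [← hn, FreeMonoid.length_mul] at this
      obtain rfl : c = 1 := FreeMonoid.length_eq_zero.1 (by omega)
      simpa using hk
    · rw [e']
      exact mul_mem_of_right hk c
  have h₂ : ∀ w ∈ residual G₂ F₂ * F₂, w ∈ G₂ := by
    rintro _ ⟨x, hx, y, hy, rfl⟩
    exact hx y hy
  have e : G₁ * (residual G₂ F₂ * F₂) = G₁ * G₂ := by
    refine SetLike.ext fun w => ⟨?_, fun hw => ?_⟩
    · rintro ⟨g, hg, k, hk, rfl⟩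
      exact ⟨g, hg, k, h₂ k hk, rfl⟩
    · rw [← h] at hw
      obtain ⟨x, hx, y, hy, rfl⟩ := hw
      rw [← mul_assoc]
      exact ⟨x, h₁ x hx, y, hy, rfl⟩
  refine ⟨residual G₂ F₂, mul_right_cancel_of_nonempty hF ?_,
    (mul_left_cancel_of_nonempty hG e).symm⟩
  rw [h, mul_assoc, e]

/-- Equidivisibility of the monoid of nonempty final segments. -/
theorem exists_mul_eq_or_of_mul_eq_mul {F₁ F₂ G₁ G₂ : FinalSegment A}
    (hne : ((F₁ * F₂ : FinalSegment A) : Set (FreeMonoid A)).Nonempty)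
    (h : F₁ * F₂ = G₁ * G₂) :
    (∃ H, F₁ = G₁ * H ∧ G₂ = H * F₂) ∨ ∃ H, G₁ = F₁ * H ∧ F₂ = H * G₂ := by
  have hne' := hne
  rw [h] at hne'
  rcases subset_or_subset_of_mul_eq_mul (nonempty_right_of_mul hne)
    (nonempty_right_of_mul hne') h with hs | hs
  · exact .inl (exists_mul_eq_of_subset (nonempty_right_of_mul hne)
      (nonempty_left_of_mul hne') h hs)
  · exact .inr (exists_mul_eq_of_subset (nonempty_right_of_mul hne')
      (nonempty_left_of_mul hne) h.symm hs)

/-! ### Factorization into irreducibles -/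

theorem ne_one_of_irreducible {F : FinalSegment A} (h : IsIrreducibleSegment F) : F ≠ 1 := by
  rintro rfl
  exact h.1 rfl

/-- Otherwise irreducibility forces `H = F`, and cancelling `F` in `F = G * F` gives `G = 1`. -/
theorem eq_of_irreducible_eq_mul {F G H : FinalSegment A} (hF : IsIrreducibleSegment F)
    (hne : (F : Set (FreeMonoid A)).Nonempty) (hG : G ≠ 1) (h : F = G * H) : F = G := by
  by_contra hGF
  have hHF : H = F := by
    by_contra hHF
    exact hF.2 ⟨G, H, Ne.symm hGF, hHF, h⟩
  rw [hHF] at h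
  exact hG (mul_right_cancel_of_nonempty hne (by rw [← h, one_mul]))

theorem eq_of_prod_eq {l l' : List (FinalSegment A)} (hl : ∀ G ∈ l, IsIrreducibleSegment G)
    (hl' : ∀ G ∈ l', IsIrreducibleSegment G)
    (hne : (l.prod : Set (FreeMonoid A)).Nonempty) (h : l.prod = l'.prod) : l = l' := by
  have prod_ne_one : ∀ (a : FinalSegment A) (t : List (FinalSegment A)),
      IsIrreducibleSegment a → (a * t.prod) ≠ 1 := by
    intro a t ha e
    have h1 : (1 : FreeMonoid A) ∈ a * t.prod := e ▸ mem_one 1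
    obtain ⟨x, hx, y, -, hxy⟩ := h1
    obtain ⟨rfl, -⟩ := List.append_eq_nil_iff.1 hxy
    exact ne_one_of_irreducible ha (eq_one_of_one_mem hx)
  induction l generalizing l' with
  | nil =>
    cases l' with
    | nil => rfl
    | cons b s =>
      rw [List.prod_nil, List.prod_cons] at h
      exact absurd h.symm (prod_ne_one b s (hl' b (by simp)))
  | cons a t ih =>
    cases l' with
    | nil =>
      rw [List.prod_nil, List.prod_cons] at h
      exact absurd h (prod_ne_one a t (hl a (by simp)))
    | cons b s =>
      rw [List.prod_cons] at hne
      rw [List.prod_cons, List.prod_cons] at h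
      have ha := hl a (by simp)
      have hb := hl' b (by simp)
      have hab : a = b := by
        rcases exists_mul_eq_or_of_mul_eq_mul hne h with ⟨H, e, -⟩ | ⟨H, e, -⟩
        · exact eq_of_irreducible_eq_mul ha (nonempty_left_of_mul hne)
            (ne_one_of_irreducible hb) e
        · exact (eq_of_irreducible_eq_mul hb (nonempty_left_of_mul (h ▸ hne))
            (ne_one_of_irreducible ha) e).symm
      subst hab
      rw [ih (fun G hG => hl G (by simp [hG])) (fun G hG => hl' G (by simp [hG]))
        (nonempty_right_of_mul hne)
        (mul_left_cancel_of_nonempty (nonempty_left_of_mul hne) h)]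

theorem exists_prod_eq (F : FinalSegment A) (hF : (F : Set (FreeMonoid A)).Nonempty) :
    ∃ l : List (FinalSegment A), (∀ G ∈ l, IsIrreducibleSegment G) ∧ l.prod = F := by
  induction hn : F.minLength using Nat.strong_induction_on generalizing F with
  | _ n ih =>
    subst hn
    by_cases h1 : F = 1
    · exact ⟨[], by simp, by simp [h1]⟩
    by_cases hirr : IsIrreducibleSegment F
    · exact ⟨[F], by simpa using hirr, by simp⟩
    obtain ⟨G, H, hG, hH, rfl⟩ : ∃ G H : FinalSegment A, G ≠ F ∧ H ≠ F ∧ F = G * H := by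
      by_contra hc
      exact hirr ⟨fun hu => h1 (UpperSet.ext hu), hc⟩
    have hGn := nonempty_left_of_mul hF
    have hHn := nonempty_right_of_mul hF
    -- Were one factor `1`, the other would equal the product. So both have positive minimal length,
    -- and each is strictly below the sum.
    have hG' := minLength_pos hGn (by rintro rfl; exact hH (one_mul H).symm)
    have hH' := minLength_pos hHn (by rintro rfl; exact hG (mul_one G).symm)
    have hadd := minLength_mul hGn hHn
    obtain ⟨l, hl, rfl⟩ := ih _ (by omega) G hGn rfl
    obtain ⟨l', hl', rfl⟩ := ih _ (by omega) H hHn rfl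
    refine ⟨l ++ l', fun K hK => ?_, List.prod_append⟩
    exact (List.mem_append.1 hK).elim (hl K) (hl' K)

/-- Places the irreducible factors of a nonempty segment among the free generators, which are
required to be nonempty. -/
theorem nonempty_of_mem_of_nonempty_prod {l : List (FinalSegment A)}
    (h : (l.prod : Set (FreeMonoid A)).Nonempty) :
    ∀ G ∈ l, (G : Set (FreeMonoid A)).Nonempty := by
  induction l with
  | nil => simp
  | cons a t ih =>
    rw [List.prod_cons] at h
    rintro G (_ | ⟨_, hG⟩)
    · exact nonempty_left_of_mul h
    · exact ih (nonempty_right_of_mul h) G hG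

variable (A) in
/-- The nonempty irreducible final segments. -/
abbrev Irreducibles : Type u :=
  {F : nonemptyFinalSegments A // IsIrreducibleSegment (F : FinalSegment A)}

theorem coe_lift_ofList (l : List (Irreducibles A)) :
    ((FreeMonoid.lift Subtype.val (FreeMonoid.ofList l) : nonemptyFinalSegments A) :
      FinalSegment A) = (l.map fun F => (F.1 : FinalSegment A)).prod := by
  rw [FreeMonoid.lift_ofList, Submonoid.coe_list_prod, List.map_map]
  rfl

theorem lift_irreducibles_bijective :
    Function.Bijective (FreeMonoid.lift (Subtype.val : Irreducibles A → nonemptyFinalSegments A)) := by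
  constructor
  · intro x y hxy
    have e := congrArg (Subtype.val : nonemptyFinalSegments A → FinalSegment A) hxy
    rw [← FreeMonoid.ofList_toList x, ← FreeMonoid.ofList_toList y, coe_lift_ofList,
      coe_lift_ofList] at e
    have hirr : ∀ l : List (Irreducibles A),
        ∀ G ∈ l.map fun F => (F.1 : FinalSegment A), IsIrreducibleSegment G := by
      intro l G hG
      obtain ⟨F, -, rfl⟩ := List.mem_map.1 hG
      exact F.2
    have := eq_of_prod_eq (hirr _) (hirr _)
      (by rw [← coe_lift_ofList]; exact (FreeMonoid.lift Subtype.val _ : nonemptyFinalSegments A).2) e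
    exact FreeMonoid.toList.injective
      (List.map_injective_iff.2 (Subtype.val_injective.comp Subtype.val_injective) this)
  · rintro ⟨F, hF⟩
    obtain ⟨l, hl, rfl⟩ := exists_prod_eq F hF
    have hn := nonempty_of_mem_of_nonempty_prod hF
    refine ⟨FreeMonoid.ofList (l.attach.map fun G => ⟨⟨G.1, hn G.1 G.2⟩, hl G.1 G.2⟩), ?_⟩
    apply Subtype.ext
    rw [coe_lift_ofList, List.map_map]
    exact congrArg List.prod (List.attach_map_subtype_val l)

end FinalSegment

theorem mainTheorem4 (A : Type u) [PartialOrder A] :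
    (∃ X : Type u, Nonempty (nonemptyFinalSegments A ≃* FreeMonoid X)) ∧
      ∀ F ∈ nonemptyFinalSegments A,
        ∃! l : List (FinalSegment A), (∀ G ∈ l, IsIrreducibleSegment G) ∧ l.prod = F := by
  refine ⟨⟨FinalSegment.Irreducibles A,
    ⟨(MulEquiv.ofBijective _ FinalSegment.lift_irreducibles_bijective).symm⟩⟩, fun F hF => ?_⟩
  obtain ⟨l, hl, rfl⟩ := FinalSegment.exists_prod_eq F hF
  exact ⟨l, ⟨hl, rfl⟩, fun l' hl' =>
    (FinalSegment.eq_of_prod_eq hl hl'.1 hF hl'.2.symm).symm⟩
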